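/- \textbf{Conventions.} A proper left-invariant metric on a group $G$ is a metric $d$ with $d(gx,gy)=d(x,y)$ for all $g,x,y\in G$ all of whose balls are finite. A map $f:(X,d_X)\to(Y,d_Y)$ is coarse if for every $\delta>0$ there is $\varepsilon>0$ such that $d_X(x,y)\le\delta$ implies $d_Y(f(x),f(y))\le\varepsilon$; it is a coarse equivalence if it is coarse and there is a coarse map $g:Y\to X$ such that $d_X(g(f(x)),x)$ and $d_Y(f(g(y)),y)$ are bounded uniformly in $x\in X$ and $y\in Y$. Two groups are coarsely equivalent if both carry proper left-invariant metrics and, for every choice of such metrics on them, there is a coarse equivalence between them. A short exact sequence $0\to K\xrightarrow{i}G\xrightarrow{\pi}Q\to0$ is coarsely split if there are proper left-invariant metrics $d_K,d_G,d_Q$ and a coarse equivalence $f:(G,d_G)\to(K\oplus Q,\,d_K\oplus d_Q)$, where $d_K\oplus d_Q$ is the sum ($\ell^1$) metric, such that the distance from $f(i(k))$ to $(k,0)$ is bounded uniformly in $k\in K$, and the distance from the $Q$-coordinate of $f(g)$ to $\pi(g)$ is bounded uniformly in $g\in G$. A maximal independent free system of an abelian group $G$ is a $\mathbb Z$-linearly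 independent subset of $G$ that is maximal with respect to inclusion. \textbf{Theorem.} Let $G$ be a countable abelian group of finite torsion-free rank $n=\dim_{\mathbb Q}(G\otimes\mathbb Q)<\infty$, and let $H$ be the subgroup of $G$ generated by a maximal independent free system of elements of $G$. Then $H\cong\mathbb Z^n$, the quotient $G/H$ is a torsion group and is locally finite (every finitely generated subgroup of it is finite), and the exact sequence $$0\to H\to G\to G/H\to 0,$$ whose maps are the inclusion and the quotient map, is coarsely split. Hence $G$ is coarsely equivalent to $H\oplus G/H$, and so to $\mathbb Z^n\oplus G/H$. -/

import Mathlib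

open scoped TensorProduct

/-! Metrics are given by their distance functions, since several metrics on one group are
compared. Groups are written additively; they need not be commutative unless said so. -/

/-- `d` is a proper left-invariant metric on the group `G`: a metric, invariant under left
translations, all of whose balls are finite. -/
structure IsProperLeftInvMetric {G : Type*} [AddGroup G] (d : G → G → ℝ) : Prop where
  eq_zero_iff : ∀ x y, d x y = 0 ↔ x = y
  comm : ∀ x y, d x y = d y x
  triangle : ∀ x y z, d x z ≤ d x y + d y z
  left_inv : ∀ g x y, d (g + x) (g + y) = d x y
  proper : ∀ K : ℝ, {g : G | d 0 g ≤ K}.Finite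

/-- `f : (X, dX) → (Y, dY)` is a coarse map. -/
def IsCoarseMap {X Y : Type*} (dX : X → X → ℝ) (dY : Y → Y → ℝ) (f : X → Y) : Prop :=
  ∀ δ : ℝ, 0 < δ → ∃ ε : ℝ, 0 < ε ∧ ∀ x y, dX x y ≤ δ → dY (f x) (f y) ≤ ε

/-- `f : (X, dX) → (Y, dY)` is a coarse equivalence: a coarse map that has a coarse inverse. -/
def IsCoarseEquivalence {X Y : Type*} (dX : X → X → ℝ) (dY : Y → Y → ℝ) (f : X → Y) : Prop :=
  IsCoarseMap dX dY f ∧ ∃ g : Y → X, IsCoarseMap dY dX g ∧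
    ∃ K₁ K₂ : ℝ, 0 < K₁ ∧ 0 < K₂ ∧ (∀ x, dX (g (f x)) x ≤ K₁) ∧ (∀ y, dY (f (g y)) y ≤ K₂)

/-- The sum (`ℓ¹`) metric on a product. -/
def sumMetric {X Y : Type*} (dX : X → X → ℝ) (dY : Y → Y → ℝ) (p q : X × Y) : ℝ :=
  dX p.1 q.1 + dY p.2 q.2

/-- `0 → K → G → H → 0` (with maps `i` and `π`) is a short exact sequence of groups that is
coarsely split: for some proper left-invariant metrics there is a coarse equivalence
`f : G → K ⊕ H` such that `f ∘ i` is at bounded distance from the inclusion `k ↦ (k, 0)`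
and the second coordinate of `f` is at bounded distance from `π`. -/
def CoarselySplit {K G H : Type*} [AddGroup K] [AddGroup G] [AddGroup H]
    (i : K →+ G) (π : G →+ H) : Prop :=
  Function.Injective i ∧ Function.Exact i π ∧ Function.Surjective π ∧
  ∃ (dK : K → K → ℝ) (dG : G → G → ℝ) (dH : H → H → ℝ),
    IsProperLeftInvMetric dK ∧ IsProperLeftInvMetric dG ∧ IsProperLeftInvMetric dH ∧
    ∃ f : G → K × H, IsCoarseEquivalence dG (sumMetric dK dH) f ∧
      (∃ C : ℝ, ∀ k, sumMetric dK dH (f (i k)) (k, 0) ≤ C) ∧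
      (∃ C : ℝ, ∀ g, dH (f g).2 (π g) ≤ C)

/-- Two groups are coarsely equivalent: they carry proper left-invariant metrics, and they are
coarsely equivalent as metric spaces whichever such metrics are chosen. -/
def CoarselyEquivalentGroups (G G' : Type*) [AddGroup G] [AddGroup G'] : Prop :=
  (∃ d : G → G → ℝ, IsProperLeftInvMetric d) ∧
  (∃ d' : G' → G' → ℝ, IsProperLeftInvMetric d') ∧
  ∀ (d : G → G → ℝ) (d' : G' → G' → ℝ), IsProperLeftInvMetric d → IsProperLeftInvMetric d' →
    ∃ f : G → G', IsCoarseEquivalence d d' f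

/-- `G` is locally finite: every finitely generated subgroup is finite. -/
def IsLocallyFiniteGroup (G : Type*) [AddGroup G] : Prop :=
  ∀ K : AddSubgroup G, K.FG → Finite K

/-- `S` is a maximal independent free system of the abelian group `G`: maximal (for inclusion)
among the sets of elements of infinite order that are independent, i.e. among the
`ℤ`-linearly independent subsets. -/
def IsMaximalIndependentFreeSystem {G : Type*} [AddCommGroup G] (S : Set G) : Prop :=
  Maximal (fun T : Set G => LinearIndepOn ℤ id T) S

/-! Since `H ≅ ℤⁿ` embeds in the divisible group `ℚⁿ`, the isomorphism extends to a homomorphism `ψ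
: G → ℚⁿ`. Taking floors coordinatewise gives a retraction `r : G → H` that commutes with
translation by `H`. It is not additive, but for fixed `g` the error in `r (x + g) - r x` is bounded,
so this difference takes finitely many values (`exists_equivariant_retraction`). Hence `g ↦ (r g, g
+ H)` is a bijection onto `H × G ⧸ H`, and it and its inverse have finite differences
(`exists_equiv_prod_quotient`). Balls being finite, such maps are coarse for all proper
left-invariant metrics at once. -/

/-- A map between groups all of whose differences `-f x + f (x + g)` take, for fixed `g`, only
finitely many values. -/
def HasFiniteDifferences {G G' : Type*} [AddGroup G] [AddGroup G'] (f : G → G') : Prop :=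
  ∀ g, (Set.range fun x => -f x + f (x + g)).Finite

namespace IsProperLeftInvMetric

variable {G G' : Type*} [AddGroup G] [AddGroup G'] {d : G → G → ℝ} {d' : G' → G' → ℝ}

lemma self (hd : IsProperLeftInvMetric d) (x : G) : d x x = 0 := (hd.eq_zero_iff x x).2 rfl

lemma nonneg (hd : IsProperLeftInvMetric d) (x y : G) : 0 ≤ d x y := by
  have := hd.triangle x y x
  rw [hd.self, hd.comm y x] at this
  linarith

lemma eq_dist_zero (hd : IsProperLeftInvMetric d) (x y : G) : d x y = d 0 (-x + y) := by
  rw [← hd.left_inv (-x) x y, neg_add_cancel]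

lemma sumMetric (hd : IsProperLeftInvMetric d) (hd' : IsProperLeftInvMetric d') :
    IsProperLeftInvMetric (sumMetric d d') where
  eq_zero_iff x y := by
    have h₁ := hd.nonneg x.1 y.1
    have h₂ := hd'.nonneg x.2 y.2
    rw [Prod.ext_iff, ← hd.eq_zero_iff, ← hd'.eq_zero_iff]
    exact add_eq_zero_iff_of_nonneg h₁ h₂
  comm x y := by simp only [_root_.sumMetric, hd.comm x.1, hd'.comm x.2]
  triangle x y z := by
    have h₁ := hd.triangle x.1 y.1 z.1
    have h₂ := hd'.triangle x.2 y.2 z.2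
    simp only [_root_.sumMetric]
    linarith
  left_inv g x y := by
    simp only [_root_.sumMetric, Prod.fst_add, Prod.snd_add, hd.left_inv, hd'.left_inv]
  proper K := by
    refine ((hd.proper K).prod (hd'.proper K)).subset fun g (hg : d 0 g.1 + d' 0 g.2 ≤ K) => ?_
    have h₁ := hd.nonneg 0 g.1
    have h₂ := hd'.nonneg 0 g.2
    exact ⟨show d 0 g.1 ≤ K by linarith, show d' 0 g.2 ≤ K by linarith⟩

end IsProperLeftInvMetric

/-! ### Weighted word metrics on countable groups. -/

section WordNorm

variable {G : Type*} [AddGroup G] (w : G → ℕ)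

/-- The least total weight of a list with sum `g`. -/
noncomputable def weightedWordNorm (g : G) : ℕ :=
  sInf {n | ∃ l : List G, l.sum = g ∧ (l.map w).sum = n}

lemma weightedWordNorm_sum_le (l : List G) : weightedWordNorm w l.sum ≤ (l.map w).sum :=
  Nat.sInf_le ⟨l, rfl, rfl⟩

lemma exists_list_weightedWordNorm (g : G) :
    ∃ l : List G, l.sum = g ∧ (l.map w).sum = weightedWordNorm w g :=
  Nat.sInf_mem (s := {n | ∃ l : List G, l.sum = g ∧ (l.map w).sum = n})
    ⟨w g, [g], by simp, by simp⟩

lemma weightedWordNorm_zero : weightedWordNorm w (0 : G) = 0 :=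
  Nat.le_zero.1 (weightedWordNorm_sum_le w [])

lemma weightedWordNorm_add_le (g h : G) :
    weightedWordNorm w (g + h) ≤ weightedWordNorm w g + weightedWordNorm w h := by
  obtain ⟨l, hl, hl'⟩ := exists_list_weightedWordNorm w g
  obtain ⟨m, hm, hm'⟩ := exists_list_weightedWordNorm w h
  simpa [hl, hm, hl', hm'] using weightedWordNorm_sum_le w (l ++ m)

variable {w}

lemma weightedWordNorm_neg_le (hneg : ∀ g, w (-g) = w g) (g : G) :
    weightedWordNorm w (-g) ≤ weightedWordNorm w g := by
  obtain ⟨l, rfl, hl⟩ := exists_list_weightedWordNorm w g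
  rw [← hl, List.sum_neg_reverse]
  refine (weightedWordNorm_sum_le w _).trans_eq ?_
  rw [List.map_reverse, List.sum_reverse, List.map_map]
  congr 2
  exact funext hneg

lemma weightedWordNorm_eq_zero_iff (hpos : ∀ g, 0 < w g) {g : G} :
    weightedWordNorm w g = 0 ↔ g = 0 := by
  refine ⟨fun h => ?_, fun h => h ▸ weightedWordNorm_zero w⟩
  obtain ⟨l, rfl, hl⟩ := exists_list_weightedWordNorm w g
  rw [h] at hl
  cases l with
  | nil => rfl
  | cons a l =>
    have := hpos a
    simp only [List.map_cons, List.sum_cons] at hl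
    omega

/-- Weights are at least 1, so dropping the first letter of a minimal list lands in a strictly
smaller ball. -/
lemma finite_weightedWordNorm_le (hpos : ∀ g, 0 < w g) (hfin : ∀ k, {g | w g ≤ k}.Finite) (k : ℕ) :
    {g : G | weightedWordNorm w g ≤ k}.Finite := by
  induction k with
  | zero =>
    refine (Set.finite_singleton (0 : G)).subset fun g hg => ?_
    exact (weightedWordNorm_eq_zero_iff hpos).1 (Nat.le_zero.1 hg)
  | succ k ih =>
    refine ((Set.finite_singleton (0 : G)).union
      (Set.Finite.image2 (· + ·) (hfin (k + 1)) ih)).subset fun g hg => ?_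
    obtain ⟨l, rfl, hl⟩ := exists_list_weightedWordNorm w g
    cases l with
    | nil => exact Or.inl rfl
    | cons a l =>
      rw [Set.mem_ofPred_eq, ← hl, List.map_cons, List.sum_cons] at hg
      have := hpos a
      have := weightedWordNorm_sum_le w l
      exact Or.inr ⟨a, show w a ≤ k + 1 by omega, l.sum,
        show weightedWordNorm w l.sum ≤ k by omega, by simp⟩

end WordNorm

/-- Every countable group carries a proper left-invariant metric. -/
theorem exists_isProperLeftInvMetric (G : Type*) [AddGroup G] [Countable G] :
    ∃ d : G → G → ℝ, IsProperLeftInvMetric d := by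
  obtain ⟨e, he⟩ := exists_injective_nat G
  -- The term `e (-g)` makes `w` even, the `+ 1` makes it positive, and injectivity of `e` makes its
  -- sublevel sets finite.
  let w : G → ℕ := fun g => e g + e (-g) + 1
  have hneg : ∀ g, w (-g) = w g := fun g => by simp only [w, neg_neg]; omega
  have hpos : ∀ g, 0 < w g := fun g => Nat.succ_pos _
  have hfin : ∀ k, {g | w g ≤ k}.Finite := fun k =>
    ((Set.finite_Iic k).preimage he.injOn).subset fun g hg => by
      simp only [w, Set.mem_ofPred_eq, Set.mem_preimage, Set.mem_Iic] at hg ⊢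
      omega
  refine ⟨fun x y => weightedWordNorm w (-x + y), fun x y => ?_, fun x y => ?_, fun x y z => ?_,
    fun g x y => ?_, fun K => ?_⟩
  · rw [Nat.cast_eq_zero, weightedWordNorm_eq_zero_iff hpos, neg_add_eq_zero]
  · have h₁ := weightedWordNorm_neg_le hneg (-x + y)
    have h₂ := weightedWordNorm_neg_le hneg (-y + x)
    rw [neg_add_rev, neg_neg] at h₁ h₂
    rw [h₁.antisymm h₂]
  · have := weightedWordNorm_add_le w (-x + y) (-y + z)
    rw [add_assoc, add_neg_cancel_left] at this
    exact_mod_cast this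
  · rw [neg_add_rev, add_assoc, neg_add_cancel_left]
  · refine (finite_weightedWordNorm_le hpos hfin ⌊K⌋₊).subset fun g hg => Nat.le_floor ?_
    simpa using hg

/-! ### From finite differences to coarse maps. -/

namespace HasFiniteDifferences

variable {G G' G'' : Type*} [AddGroup G] [AddGroup G'] [AddGroup G'']

lemma of_addMonoidHom (f : G →+ G') : HasFiniteDifferences f := fun g =>
  (Set.finite_singleton (f g)).subset <| by rintro _ ⟨x, rfl⟩; simp

lemma prodMk {f : G → G'} {f' : G → G''} (hf : HasFiniteDifferences f)
    (hf' : HasFiniteDifferences f') : HasFiniteDifferences fun x => (f x, f' x) := fun g =>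
  ((hf g).prod (hf' g)).subset <| by rintro _ ⟨x, rfl⟩; exact ⟨⟨x, rfl⟩, ⟨x, rfl⟩⟩

/-- A difference of `f' ∘ f` is a difference of `f'` whose step is one of the finitely many
differences of `f`. -/
lemma comp {f' : G' → G''} {f : G → G'} (hf' : HasFiniteDifferences f')
    (hf : HasFiniteDifferences f) : HasFiniteDifferences (f' ∘ f) := fun g =>
  ((hf g).biUnion fun g' _ => hf' g').subset <| by
    rintro _ ⟨x, rfl⟩
    exact Set.mem_biUnion ⟨x, rfl⟩ ⟨f x, by simp⟩

/-- A map with finite differences is coarse for any proper left-invariant metrics. -/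
lemma isCoarseMap {f : G → G'} (hf : HasFiniteDifferences f) {d : G → G → ℝ} {d' : G' → G' → ℝ}
    (hd : IsProperLeftInvMetric d) (hd' : IsProperLeftInvMetric d') : IsCoarseMap d d' f := by
  intro δ _
  obtain ⟨C, hC⟩ := (((hd.proper δ).biUnion fun g _ => hf g).image (d' 0)).bddAbove
  refine ⟨max C 1, by positivity, fun x y hxy => le_max_of_le_left (hC ?_)⟩
  rw [hd'.eq_dist_zero]
  rw [hd.eq_dist_zero] at hxy
  exact Set.mem_image_of_mem _ (Set.mem_biUnion hxy ⟨x, by simp⟩)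

lemma isCoarseEquivalence {e : G ≃ G'} (he : HasFiniteDifferences e)
    (he' : HasFiniteDifferences e.symm) {d : G → G → ℝ} {d' : G' → G' → ℝ}
    (hd : IsProperLeftInvMetric d) (hd' : IsProperLeftInvMetric d') :
    IsCoarseEquivalence d d' e :=
  ⟨he.isCoarseMap hd hd', e.symm, he'.isCoarseMap hd' hd, 1, 1, one_pos, one_pos,
    fun x => by rw [e.symm_apply_apply, hd.self]; exact zero_le_one,
    fun y => by rw [e.apply_symm_apply, hd'.self]; exact zero_le_one⟩

lemma coarselyEquivalentGroups [Countable G] [Countable G'] {e : G ≃ G'}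
    (he : HasFiniteDifferences e) (he' : HasFiniteDifferences e.symm) :
    CoarselyEquivalentGroups G G' :=
  ⟨exists_isProperLeftInvMetric G, exists_isProperLeftInvMetric G',
    fun _ _ hd hd' => ⟨e, he.isCoarseEquivalence he' hd hd'⟩⟩

end HasFiniteDifferences

/-! ### The floor retraction and the splitting. -/

section FreeSubgroup

variable {G : Type*} [AddCommGroup G] {H : AddSubgroup G} {n : ℕ}

/-- A homomorphism from a subgroup to `ℤⁿ` extends to a homomorphism to `ℚⁿ`. -/
lemma exists_rat_extension (φ : H →+ (Fin n → ℤ)) :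
    ∃ ψ : G →+ (Fin n → ℚ), ∀ (h : H) i, ψ h i = φ h i := by
  have key (i : Fin n) : ∃ ψ : G →+ ℚ, ψ.comp H.subtype =
      (Int.castAddHom ℚ).comp ((Pi.evalAddMonoidHom (fun _ : Fin n => ℤ) i).comp φ) :=
    (Module.Baer.of_divisible ℚ).extension_property_addMonoidHom _ H.subtype_injective _
  choose ψ hψ using key
  exact ⟨AddMonoidHom.pi ψ, fun h i => DFunLike.congr_fun (hψ i) h⟩

/-- A subgroup isomorphic to `ℤⁿ` is an equivariant coarse retract. -/
lemma exists_equivariant_retraction (φ : H ≃+ (Fin n → ℤ)) :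
    ∃ r : G → H, r 0 = 0 ∧ (∀ (g : G) (h : H), r (g + h) = r g + h) ∧
      ∀ g, (Set.range fun x => r (x + g) - r x).Finite := by
  obtain ⟨ψ, hψ⟩ := exists_rat_extension φ.toAddMonoidHom
  replace hψ : ∀ (h : H) i, ψ h i = φ h i := hψ
  refine ⟨fun g => φ.symm fun i => ⌊ψ g i⌋, ?_, fun g h => ?_, fun g => ?_⟩
  · rw [map_eq_zero_iff _ φ.symm.injective]
    ext i
    simp
  -- The values of `ψ` on `H` are integral, so they pass through the floor.
  · rw [AddEquiv.symm_apply_eq, map_add φ, φ.apply_symm_apply]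
    ext i
    simp [hψ]
  -- `⌊a + b⌋ - ⌊a⌋` is `⌊b⌋` or `⌊b⌋ + 1`.
  · refine ((Set.finite_Icc (fun i => ⌊ψ g i⌋) (fun i => ⌊ψ g i⌋ + 1)).image φ.symm).subset ?_
    rintro _ ⟨x, rfl⟩
    refine ⟨_, ⟨fun i => ?_, fun i => ?_⟩, map_sub φ.symm _ _⟩
    · have := Int.le_floor_add (ψ x i) (ψ g i)
      simp only [map_add, Pi.add_apply, Pi.sub_apply]
      omega
    · have := Int.le_floor_add_floor (ψ x i) (ψ g i)
      simp only [map_add, Pi.add_apply, Pi.sub_apply]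
      omega

/-- If `H ≅ ℤⁿ`, then `G` is in bijection with `H × G ⧸ H`, compatibly with the inclusion and the
projection, such that the bijection and its inverse have finite differences. -/
lemma exists_equiv_prod_quotient (φ : H ≃+ (Fin n → ℤ)) :
    ∃ e : G ≃ H × (G ⧸ H), HasFiniteDifferences e ∧ HasFiniteDifferences e.symm ∧
      (∀ h : H, e h = (h, 0)) ∧ ∀ g, (e g).2 = g := by
  obtain ⟨r, hr0, hr, hfin⟩ := exists_equivariant_retraction φ
  -- `s q` is the unique point of the coset `q` where `r` vanishes.
  let s : G ⧸ H → G := fun q => q.out - r q.out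
  have hs (g : G) : s g = g - r g := by
    obtain ⟨h, hh⟩ := QuotientAddGroup.mk_out_eq_add H g
    simp only [s, hh, hr, AddSubgroup.coe_add]
    abel
  have hs_mk (q : G ⧸ H) : (s q : G ⧸ H) = q := by simp [s]
  have hrs (q : G ⧸ H) : r (s q) = 0 := by
    have := hr (s q) (r q.out)
    simpa [s] using this
  let e : G ≃ H × (G ⧸ H) :=
    { toFun := fun g => (r g, g)
      invFun := fun p => s p.2 + p.1
      left_inv := fun g => by simp [hs]
      right_inv := fun p => by
        ext
        · simp [hr, hrs]
        · simp [hs_mk] }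
  have hr' : HasFiniteDifferences r := fun g => by
    simpa only [neg_add_eq_sub] using hfin g
  refine ⟨e, hr'.prodMk (.of_addMonoidHom (QuotientAddGroup.mk' H)), fun p => ?_, fun h => ?_,
    fun g => rfl⟩
  · refine ((hfin (s p.2)).image fun h : H => s p.2 - h + p.1).subset ?_
    rintro _ ⟨x, rfl⟩
    refine ⟨_, ⟨s x.2, rfl⟩, ?_⟩
    -- The defect of additivity of `s` is a value of `r`; as `r (s x.2) = 0`, it is also a
    -- difference of `r` with step `s p.2`.
    have h : s (x.2 + p.2) = s x.2 + s p.2 - r (s x.2 + s p.2) := by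
      rw [← hs, QuotientAddGroup.mk_add, hs_mk, hs_mk]
    change s p.2 - ((r (s x.2 + s p.2) - r (s x.2) : H) : G) + p.1 =
      -(s x.2 + x.1) + (s (x.2 + p.2) + (x.1 + p.1 : H))
    rw [h, hrs]
    push_cast
    abel
  · have := hr 0 h
    rw [zero_add, hr0, zero_add] at this
    exact Prod.ext this ((QuotientAddGroup.eq_zero_iff _).2 h.2)

instance [Countable G] (H : AddSubgroup G) : Countable (G ⧸ H) :=
  (QuotientAddGroup.mk'_surjective H).countable

lemma coarselySplit_of_addEquiv [Countable G] (φ : H ≃+ (Fin n → ℤ)) :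
    CoarselySplit H.subtype (QuotientAddGroup.mk' H) := by
  obtain ⟨e, he, he', heH, heQ⟩ := exists_equiv_prod_quotient φ
  obtain ⟨dH, hdH⟩ := exists_isProperLeftInvMetric H
  obtain ⟨dG, hdG⟩ := exists_isProperLeftInvMetric G
  obtain ⟨dQ, hdQ⟩ := exists_isProperLeftInvMetric (G ⧸ H)
  refine ⟨H.subtype_injective, fun g => by simp, QuotientAddGroup.mk'_surjective H,
    dH, dG, dQ, hdH, hdG, hdQ, e, he.isCoarseEquivalence he' hdG (hdH.sumMetric hdQ),
    ⟨0, fun h => ?_⟩, ⟨0, fun g => ?_⟩⟩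
  · rw [H.subtype_apply, heH, (hdH.sumMetric hdQ).self]
  · rw [heQ, QuotientAddGroup.mk'_apply, hdQ.self]

end FreeSubgroup

/-! ### Maximal independent systems: torsion quotient and rank. -/

section MaximalIndependent

variable {G : Type*} [AddCommGroup G] {S : Set G}

/-- Otherwise `g` is independent modulo the span, and adjoining it to `S` contradicts maximality. -/
lemma IsMaximalIndependentFreeSystem.exists_zsmul_mem (hS : IsMaximalIndependentFreeSystem S)
    (g : G) : ∃ m : ℤ, m ≠ 0 ∧ m • g ∈ Submodule.span ℤ S := by
  by_contra! hg
  have hind : LinearIndepOn ℤ id (S ∪ {g}) := by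
    refine hS.prop.union_of_quotient ?_
    rw [Set.image_id, ← Finset.coe_singleton, linearIndepOn_finset_iff]
    intro a ha x hx
    rw [Finset.mem_singleton] at hx
    subst hx
    by_contra hax
    refine hg _ hax ?_
    rw [Finset.sum_singleton, Function.comp_apply, Submodule.mkQ_apply,
      ← Submodule.Quotient.mk_smul, Submodule.Quotient.mk_eq_zero] at ha
    exact ha
  have hgS : g ∈ S := hS.le_of_ge hind Set.subset_union_left (Or.inr rfl)
  exact hg 1 one_ne_zero (by simpa using Submodule.subset_span hgS)

lemma IsMaximalIndependentFreeSystem.isAddTorsion (hS : IsMaximalIndependentFreeSystem S) :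
    IsAddTorsion (G ⧸ AddSubgroup.closure S) := by
  intro q
  induction q using QuotientAddGroup.induction_on with
  | H g =>
    obtain ⟨m, hm, hmg⟩ := hS.exists_zsmul_mem g
    rw [← Submodule.mem_toAddSubgroup, Submodule.span_int_eq_addSubgroupClosure] at hmg
    refine isOfFinAddOrder_iff_zsmul_eq_zero.2 ⟨m, hm, ?_⟩
    rw [← QuotientAddGroup.mk_zsmul]
    exact (QuotientAddGroup.eq_zero_iff _).2 hmg

/-- The quotient by the span is torsion, so it has rank 0, and rank is additive and invariant under
base change to `ℚ`. -/
lemma IsMaximalIndependentFreeSystem.mk_eq_rank (hS : IsMaximalIndependentFreeSystem S) :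
    Cardinal.mk S = Module.rank ℚ (ℚ ⊗[ℤ] G) := by
  have h₀ : Module.rank ℤ (G ⧸ Submodule.span ℤ S) = 0 := by
    refine rank_eq_zero_iff.2 fun q => ?_
    obtain ⟨g, rfl⟩ := Submodule.Quotient.mk_surjective _ q
    obtain ⟨m, hm, hmg⟩ := hS.exists_zsmul_mem g
    exact ⟨m, hm, by rwa [← Submodule.Quotient.mk_smul, Submodule.Quotient.mk_eq_zero]⟩
  rw [(TensorProduct.isBaseChange ℤ G ℚ).rank_eq,
    ← rank_quotient_add_rank_of_isDomain (Submodule.span ℤ S), h₀, zero_add,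
    rank_span_set hS.prop]

lemma IsMaximalIndependentFreeSystem.nonempty_addEquiv (hS : IsMaximalIndependentFreeSystem S)
    [FiniteDimensional ℚ (ℚ ⊗[ℤ] G)] :
    Nonempty (AddSubgroup.closure S ≃+ (Fin (Module.finrank ℚ (ℚ ⊗[ℤ] G)) → ℤ)) := by
  have hfin : Finite S := by
    rw [← Cardinal.lt_aleph0_iff_finite, hS.mk_eq_rank]
    exact Module.rank_lt_aleph0 _ _
  have hcard : Nat.card S = Module.finrank ℚ (ℚ ⊗[ℤ] G) := by
    rw [Nat.card, hS.mk_eq_rank, Module.finrank]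
  let b := (Module.Basis.span (LinearIndepOn.linearIndependent hS.prop)).reindex
    (Finite.equivFinOfCardEq hcard)
  have hspan : AddSubgroup.closure S =
      (Submodule.span ℤ (Set.range fun x : S => id (x : G))).toAddSubgroup := by
    simp [Submodule.span_int_eq_addSubgroupClosure]
  rw [hspan]
  exact ⟨b.equivFun.toAddEquiv⟩

end MaximalIndependent

lemma IsAddTorsion.isLocallyFiniteGroup {G : Type*} [AddCommGroup G] (hG : IsAddTorsion G) :
    IsLocallyFiniteGroup G := fun K hK =>
  haveI : AddGroup.FG K := (AddGroup.fg_iff_addSubgroup_fg K).2 hK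
  AddCommGroup.finite_of_fg_isAddTorsion K (hG.addSubgroup K)

theorem mainTheorem1 {G : Type*} [AddCommGroup G] [Countable G]
    (hfin : FiniteDimensional ℚ (ℚ ⊗[ℤ] G))
    (S : Set G) (hS : IsMaximalIndependentFreeSystem S)
    (H : AddSubgroup G) (hH : H = AddSubgroup.closure S)
    (n : ℕ) (hn : n = Module.finrank ℚ (ℚ ⊗[ℤ] G)) :
    Nonempty (H ≃+ (Fin n → ℤ)) ∧
    IsAddTorsion (G ⧸ H) ∧
    IsLocallyFiniteGroup (G ⧸ H) ∧
    CoarselySplit H.subtype (QuotientAddGroup.mk' H) ∧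
    CoarselyEquivalentGroups G (H × (G ⧸ H)) ∧
    CoarselyEquivalentGroups G ((Fin n → ℤ) × (G ⧸ H)) := by
  subst hH hn
  obtain ⟨φ⟩ := hS.nonempty_addEquiv
  have htors := hS.isAddTorsion
  obtain ⟨e, he, he', -⟩ := exists_equiv_prod_quotient φ
  let ε := φ.prodCongr (AddEquiv.refl (G ⧸ AddSubgroup.closure S))
  refine ⟨⟨φ⟩, htors, htors.isLocallyFiniteGroup, coarselySplit_of_addEquiv φ,
    he.coarselyEquivalentGroups he', ?_⟩
  exact HasFiniteDifferences.coarselyEquivalentGroups (e := e.trans ε.toEquiv)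
    ((HasFiniteDifferences.of_addMonoidHom ε.toAddMonoidHom).comp he)
    (he'.comp (.of_addMonoidHom ε.symm.toAddMonoidHom))
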